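/- Let $M,N\ge 1$, $L=\min(M,N)$, $0\le l\le L-1$, and put $T_l=N+M-1-2l$, $K_l=\frac{(M-l)(N-l)}{N+M-1-2l}+l$ and $n=K_lT_l$ (a positive integer). The transmission scheme $G_l$ uses $M$ antennas during $T_l$ channel uses. In channel use $i=1,\dots,|N-M|+1$ the active antennas are all $M$ antennas if $N\ge M$, and the antennas $i,\dots,i+N-1$ if $M>N$. In channel use $|N-M|+2k$ the active antennas are the first $L-k$ ones, and in channel use $|N-M|+2k+1$ they are the last $L-k$ ones, for $k=1,\dots,L-1-l$. For $H\in\mathbb C^{N\times M}$ the effective channel $H_{\rm eff}^{(l)}$ is the $NT_l\times n$ block diagonal matrix whose $i$-th block consists of the columns of $H$ belonging to the antennas active in channel use $i$. An $n$-complex-dimensional infinite constellation (IC) is a countable set $S\subset\mathbb C^{n}$ that lies in no proper complex subspace. With $\mathrm{cube}(a)\subset\mathbb C^n$ the centred cube of edge length $a$ and $M(S,a)=|S\cap\mathrm{cube}(a)|$, its transmitter density is $\gamma_{\rm tr}=\limsup_{a\to\infty}M(S,a)/a^{2n}$, its receiver density is $\gamma_{\rm rc}=\limsup_{a\to\infty}M(S,a)/\mathrm{Vol}(H_{\rm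 eff}^{(l)}\mathrm{cube}(a))$ with $2n$-dimensional real volume, and its receiver volume-to-noise ratio is $\mu_{\rm rc}=\gamma_{\rm rc}^{-1/n}/(2\pi e\sigma^2)$ with $\sigma^2=\rho^{-1}/(2\pi e)$. The received vector is $y=H_{\rm eff}^{(l)}x+\rho^{-1/2}\mathbf n$ with $\mathbf n\sim CN(0,\frac{2}{2\pi e}I_{NT_l})$. The error probability $P_e(x',\rho)$ of $x'\in S'=H_{\rm eff}^{(l)}S$ is the probability that $x'+\rho^{-1/2}\mathbf n$ is not strictly closer to $x'$ than to every other point of $S'$. The average decoding error probability is $$\overline{P_e}(H_{\rm eff}^{(l)},\rho)=\limsup_{a\to\infty}\frac{1}{M(S,a)}\sum_{x'\in S'\cap H_{\rm eff}^{(l)}\mathrm{cube}(a)}P_e(x',\rho).$$ Theorem. There are constants $D(n)>0$, depending only on $n=K_lT_l$ (in particular not on $\rho$), such that the following holds for all $M,N,l$ as above, every real $r$ and every $H\in\mathbb C^{N\times M}$ for which $H_{\rm eff}^{(l)}$ has full rank $n$. There is a sequence $S(\rho)$, $\rho>1$, of $K_lT_l$-complex-dimensional ICs with transmitter density $\gamma_{\rm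 tr}=\rho^{rT_l}$ such that, writing $\rho^{-\eta_i/2}$, $1\le i\le n$, for the singular values of $H_{\rm eff}^{(l)}$, for every $\rho>1$ the receiver volume-to-noise ratio is $$\mu_{\rm rc}=\rho^{\,1-\frac{r}{K_l}-\frac{\sum_{i=1}^{n}\eta_i}{K_lT_l}}$$ and $$\overline{P_e}(H_{\rm eff}^{(l)},\rho)\le D(K_lT_l)\,\rho^{-T_l(K_l-r)+\sum_{i=1}^{n}\eta_i}=D(K_lT_l)\,\rho^{-T_l(K_l-r)}\,\bigl|H_{\rm eff}^{(l)\dagger}H_{\rm eff}^{(l)}\bigr|^{-1}.$$ -/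

import Mathlib

open MeasureTheory ProbabilityTheory Filter
open scoped ENNReal NNReal

namespace MIMO

noncomputable section

/-! ### The transmission scheme and its effective channel

There are `M` transmit antennas, `N` receive antennas and `0 ≤ l < min M N`.
Antennas and channel uses are numbered from `0`. -/

/-- The number of channel uses, `T_l = N + M - 1 - 2l`. -/
def channelUses (M N l : ℕ) : ℕ := N + M - 1 - 2 * l

/-- The average number of dimensions per channel use,
`K_l = (M - l)(N - l) / (N + M - 1 - 2l) + l`. -/
def dimPerUse (M N l : ℕ) : ℝ :=
  ((M : ℝ) - l) * ((N : ℝ) - l) / ((N : ℝ) + M - 1 - 2 * l) + l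

/-- The difference `|N - M|`; the first `|N - M| + 1` channel uses carry `min M N` symbols each. -/
def gap (M N : ℕ) : ℕ := max M N - min M N

/-- The first antenna that is active in channel use `t`.
In the channel uses `t ≤ |N - M|` the active antennas are all of them if `M ≤ N`, and the `N`
antennas `t, …, t + N - 1` if `N < M`.  Then come pairs of channel uses, numbered `k = 1, 2, …`:
the first member of the `k`-th pair, `t = |N - M| + 2k - 1`, uses the first `min M N - k` antennas,
and the second one, `t = |N - M| + 2k`, uses the last `min M N - k` antennas. -/
def firstAntenna (M N t : ℕ) : ℕ :=
  if t ≤ gap M N then (if M ≤ N then 0 else t)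
  else if (t - gap M N) % 2 = 1 then 0
  else M - min M N + (t - gap M N) / 2

/-- The number of consecutive antennas that are active in channel use `t`. -/
def numAntennas (M N t : ℕ) : ℕ :=
  if t ≤ gap M N then min M N else min M N - (t - gap M N + 1) / 2

/-- The non-zero entries of the transmission matrix `G_l`: the pairs (channel use, antenna)
that carry a complex symbol.  An infinite constellation of symbols is a subset of
`EuclideanSpace ℂ (SymbolIndex M N l)`. -/
abbrev SymbolIndex (M N l : ℕ) : Type :=
  {p : Fin (channelUses M N l) × Fin M //
    firstAntenna M N p.1 ≤ p.2 ∧ (p.2 : ℕ) < firstAntenna M N p.1 + numAntennas M N p.1}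

/-- The effective channel `H_eff^(l)`: the block diagonal matrix whose `t`-th block consists of
the columns of `H` that belong to the antennas active in channel use `t`. -/
def effectiveChannel {M N : ℕ} (l : ℕ) (H : Matrix (Fin N) (Fin M) ℂ) :
    Matrix (Fin (channelUses M N l) × Fin N) (SymbolIndex M N l) ℂ :=
  fun i j => if i.1 = j.1.1 then H i.2 j.1.2 else 0

/-! ### Infinite constellations -/

section Constellations

variable {ι κ : Type*} [Fintype ι] [DecidableEq ι] [Fintype κ]

/-- `S` is an infinite constellation of full complex dimension in `ℂ^ι`: it is countable and
lies in no proper complex subspace. -/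
def IsConstellation (S : Set (EuclideanSpace ℂ ι)) : Prop :=
  S.Countable ∧ Module.finrank ℂ (Submodule.span ℂ S) = Fintype.card ι

/-- The centred cube with edge length `a` in `ℂ^ι`. -/
def cube (ι : Type*) (a : ℝ) : Set (EuclideanSpace ℂ ι) :=
  {x | ∀ i, |(x i).re| ≤ a / 2 ∧ |(x i).im| ≤ a / 2}

/-- `M(S, a)`, the number of points of `S` in the cube with edge length `a`. -/
def numPoints (S : Set (EuclideanSpace ℂ ι)) (a : ℝ) : ℝ≥0∞ :=
  ((S ∩ cube ι a).encard : ℝ≥0∞)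

/-- The transmitter density of `S`. -/
def txDensity (S : Set (EuclideanSpace ℂ ι)) : ℝ≥0∞ :=
  limsup (fun a : ℝ => numPoints S a / ENNReal.ofReal (a ^ (2 * Fintype.card ι))) atTop

/-- The image of a set under the channel matrix `A`. -/
def throughChannel (A : Matrix κ ι ℂ) (S : Set (EuclideanSpace ℂ ι)) :
    Set (EuclideanSpace ℂ κ) :=
  (Matrix.toEuclideanLin A) '' S

/-- The receiver density of `S` for the channel matrix `A`; the volume of the image of the cube is
its `2n`-dimensional real Euclidean volume, `n` being the complex dimension of the cube. -/
def rxDensity (A : Matrix κ ι ℂ) (S : Set (EuclideanSpace ℂ ι)) : ℝ≥0∞ :=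
  limsup (fun a : ℝ => numPoints S a /
    (Measure.euclideanHausdorffMeasure (2 * Fintype.card ι) : Measure (EuclideanSpace ℂ κ))
      (throughChannel A (cube ι a))) atTop

/-- The noise variance per real dimension, `σ² = ρ⁻¹ / (2πe)`. -/
def noiseVariance (ρ : ℝ) : ℝ := ρ⁻¹ / (2 * Real.pi * Real.exp 1)

/-- The receiver volume-to-noise ratio `γ_rc ^ (-1/n) / (2πe σ²)`. -/
def rxVNR (A : Matrix κ ι ℂ) (S : Set (EuclideanSpace ℂ ι)) (ρ : ℝ) : ℝ≥0∞ :=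
  rxDensity A S ^ (-(1 / (Fintype.card ι : ℝ))) /
    ENNReal.ofReal (2 * Real.pi * Real.exp 1 * noiseVariance ρ)

/-- The circularly symmetric complex normal law `CN(0, v)`. -/
def complexNormal (v : ℝ≥0) : Measure ℂ :=
  ((gaussianReal 0 (v / 2)).prod (gaussianReal 0 (v / 2))).map (fun p => Complex.mk p.1 p.2)

/-- The law `CN(0, 2/(2πe) I)` of the noise vector before it is multiplied by `ρ^(-1/2)`. -/
def noiseLaw (κ : Type*) [Fintype κ] : Measure (EuclideanSpace ℂ κ) :=
  (Measure.pi fun _ : κ => complexNormal (Real.toNNReal (2 / (2 * Real.pi * Real.exp 1)))).map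
    (WithLp.toLp 2)

/-- The points that are strictly closer to `x` than to any other point of `S`. -/
def voronoiRegion (S : Set (EuclideanSpace ℂ κ)) (x : EuclideanSpace ℂ κ) :
    Set (EuclideanSpace ℂ κ) :=
  {y | ∀ z ∈ S, z ≠ x → dist y x < dist y z}

/-- The maximum-likelihood decoding error probability of the point `x` of the received
constellation `S`: the probability that `x + ρ^(-1/2) n` leaves the Voronoi region of `x`. -/
def pointError (S : Set (EuclideanSpace ℂ κ)) (ρ : ℝ) (x : EuclideanSpace ℂ κ) : ℝ≥0∞ :=
  noiseLaw κ {n | x + (ρ ^ (-(1 / 2) : ℝ) : ℝ) • n ∉ voronoiRegion S x}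

/-- The average decoding error probability of `S` over the channel matrix `A`. -/
def avgError (A : Matrix κ ι ℂ) (S : Set (EuclideanSpace ℂ ι)) (ρ : ℝ) : ℝ≥0∞ :=
  limsup (fun a : ℝ =>
    (∑' x : ↥(throughChannel A S ∩ throughChannel A (cube ι a)),
      pointError (throughChannel A S) ρ x) / numPoints S a) atTop

/-- The exponents `η_i` of the singular values: the `i`-th singular value of `A` is
`ρ ^ (-η_i / 2)`. -/
def singularExponent (A : Matrix κ ι ℂ) (ρ : ℝ) (i : ℕ) : ℝ :=
  -2 * Real.logb ρ ((Matrix.toEuclideanLin A).singularValues i)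

end Constellations

end

end MIMO

/-!
The constellation may depend on the channel, so it is chosen to look cubic at the receiver. Let
`A` be the effective channel, `n` its number of columns, and write `A = U ∘ B` with `B` an
invertible endomorphism of `ℂⁿ` and `U` a linear isometry onto the range of `A`
(`exists_isometry_comp`). The constellation is `S = B⁻¹ (d ℤ[i]ⁿ)`, so that the received
constellation is the isometric image `U (d ℤ[i]ⁿ)` of a scaled cubic lattice.

*Densities.* Counting lattice points in dilates of a convex body gives the transmitter density
`|det B|² / d²ⁿ` (`tendsto_numPoints_lattice`); since `U` preserves Hausdorff measure and `B`
multiplies volumes by `|det B|²`, the receiver density is `1 / d²ⁿ` (`rxDensity_lattice`). The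
edge `d` is fixed by the transmitter density `ρ ^ (r T)`. Moreover `|det B|²` is the determinant of
`Aᴴ A` and the product of the squared singular values, that is, `ρ ^ (-∑ ηᵢ)`.

*Error probability.* Distinct received points are at distance at least `d`, so by Cauchy–Schwarz a
decoding error forces `‖U* 𝐧‖ ≥ √ρ d / 2` (`norm_le_of_norm_sub_le`). Each of the `2n` real
coordinates of `U* 𝐧` is the real part of `⟪e, 𝐧⟫` for a unit vector `e`, whose exponential moment
does not depend on `e` nor on the number of receive antennas (`lintegral_exp_noiseLaw`). Markov's
inequality with `x²ⁿ ≤ (2n)! exp x` therefore bounds the error probability of every single point by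
`D(n) / (ρ d²)ⁿ` (`pointError_le`), and this is the asserted bound because
`d²ⁿ = ρ ^ (-r T - ∑ ηᵢ)` and `n = K T` (`card_symbolIndex`).
-/

namespace MIMO

/-! ### The number of transmitted symbols -/

/-- The active antennas are among the `M` existing ones, so that none of the symbols counted by
`numAntennas` is cut off in `SymbolIndex`. -/
theorem firstAntenna_add_numAntennas_le {M N l t : ℕ} (ht : t < channelUses M N l) :
    firstAntenna M N t + numAntennas M N t ≤ M := by
  have hg : gap M N + 2 * min M N = M + N := by simp only [gap]; omega
  unfold channelUses at ht
  unfold firstAntenna numAntennas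
  split_ifs <;> omega

theorem card_symbolIndex_eq_sum (M N l : ℕ) :
    Fintype.card (SymbolIndex M N l) =
      ∑ t ∈ Finset.range (channelUses M N l), numAntennas M N t := by
  rw [Fintype.card_subtype, Finset.card_filter, Fintype.sum_prod_type,
    ← Fin.sum_univ_eq_sum_range]
  refine Finset.sum_congr rfl fun t _ => ?_
  have ht := firstAntenna_add_numAntennas_le t.2
  rw [Fin.sum_univ_eq_sum_range (fun j => if firstAntenna M N t ≤ j ∧
    j < firstAntenna M N t + numAntennas M N t then 1 else 0) M, ← Finset.card_filter]
  have : (Finset.range M).filter (fun j => firstAntenna M N t ≤ j ∧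
      j < firstAntenna M N t + numAntennas M N t) =
      Finset.Ico (firstAntenna M N t) (firstAntenna M N t + numAntennas M N t) := by
    ext j
    simp only [Finset.mem_filter, Finset.mem_range, Finset.mem_Ico]
    omega
  rw [this, Nat.card_Ico]
  omega

/-- The total number of symbols in the first `|N - M| + 1` channel uses and the `p` pairs of channel
uses after them. -/
theorem sum_numAntennas (M N p : ℕ) (hp : p < min M N) :
    ((∑ t ∈ Finset.range (gap M N + 1 + 2 * p), numAntennas M N t : ℕ) : ℤ) =
      (gap M N + 1) * (min M N : ℕ) + p * (2 * (min M N : ℕ) - p - 1) := by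
  induction p with
  | zero =>
    have : ∀ t ∈ Finset.range (gap M N + 1), numAntennas M N t = min M N := by
      intro t ht
      have := Finset.mem_range.1 ht
      rw [numAntennas, if_pos (by omega)]
    rw [Nat.mul_zero, Nat.add_zero, Finset.sum_congr rfl this]
    simp
  | succ p ih =>
    rw [show gap M N + 1 + 2 * (p + 1) = gap M N + 1 + 2 * p + 1 + 1 by ring,
      Finset.sum_range_succ, Finset.sum_range_succ, Nat.cast_add, Nat.cast_add,
      ih (by omega)]
    have h1 : numAntennas M N (gap M N + 1 + 2 * p) = min M N - (p + 1) := by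
      rw [numAntennas, if_neg (by omega)]; omega
    have h2 : numAntennas M N (gap M N + 1 + 2 * p + 1) = min M N - (p + 1) := by
      rw [numAntennas, if_neg (by omega)]; omega
    rw [h1, h2, Nat.cast_sub hp.le]
    push_cast
    ring

theorem card_symbolIndex {M N l : ℕ} (hl : l < min M N) :
    (Fintype.card (SymbolIndex M N l) : ℝ) = dimPerUse M N l * channelUses M N l := by
  have hT : channelUses M N l = gap M N + 1 + 2 * (min M N - 1 - l) := by
    simp only [channelUses, gap]; omega
  have hTr : (channelUses M N l : ℝ) = (N : ℝ) + M - 1 - 2 * l := by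
    have : channelUses M N l + 1 + 2 * l = N + M := by simp only [channelUses]; omega
    have := congrArg (Nat.cast : ℕ → ℝ) this
    push_cast at this
    linarith
  have hT0 : (0 : ℝ) < (N : ℝ) + M - 1 - 2 * l := by
    rw [← hTr]; exact_mod_cast (by omega : 0 < channelUses M N l)
  have hsum := sum_numAntennas M N (min M N - 1 - l) (by omega)
  rw [← hT, ← card_symbolIndex_eq_sum] at hsum
  have hprod : min M N * (gap M N + min M N) = M * N := by
    rcases le_total M N with h | h
    · simp [gap, h]
    · simp [gap, h, Nat.mul_comm]
  have hsum' : (Fintype.card (SymbolIndex M N l) : ℤ) = M * N - l * l - l := by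
    zify at hprod
    rw [hsum, show ((min M N - 1 - l : ℕ) : ℤ) = (min M N : ℕ) - 1 - l by omega]
    push_cast at hprod ⊢
    linear_combination hprod
  have : (Fintype.card (SymbolIndex M N l) : ℝ) = M * N - l * l - l := by exact_mod_cast hsum'
  rw [this, hTr, dimPerUse, add_mul, div_mul_cancel₀ _ hT0.ne']
  ring

section Lattice

variable {ι κ : Type*} [Fintype ι] [Fintype κ]

/-! ### Real coordinates and volumes in `ℂ^ι` -/

/-- The real isometry `ℂ^ι ≃ ℝ^(ι ⊕ ι)` that lists the real parts and then the imaginary parts. -/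
noncomputable def realCoords (ι : Type*) [Fintype ι] :
    EuclideanSpace ℂ ι ≃ₗᵢ[ℝ] EuclideanSpace ℝ (ι ⊕ ι) where
  toFun x := WithLp.toLp 2 (Sum.elim (fun i => (x i).re) (fun i => (x i).im))
  invFun y := WithLp.toLp 2 (fun i => ⟨y (.inl i), y (.inr i)⟩)
  map_add' x y := by ext (i | i) <;> simp
  map_smul' c x := by ext (i | i) <;> simp
  left_inv x := by ext i; simp
  right_inv y := by ext (i | i) <;> simp
  norm_map' x := by
    simp [EuclideanSpace.norm_eq, Fintype.sum_sum_type, ← Finset.sum_add_distrib,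
      Complex.sq_norm, Complex.normSq_apply, ← sq]

@[simp] theorem realCoords_inl (x : EuclideanSpace ℂ ι) (i : ι) :
    realCoords ι x (.inl i) = (x i).re := rfl

@[simp] theorem realCoords_inr (x : EuclideanSpace ℂ ι) (i : ι) :
    realCoords ι x (.inr i) = (x i).im := rfl

/-- `realCoords` with values in plain functions, where the volume is the product measure and
lattice points can be counted. -/
noncomputable def realPi (ι : Type*) [Fintype ι] : EuclideanSpace ℂ ι ≃ₗ[ℝ] (ι ⊕ ι → ℝ) :=
  (realCoords ι).toLinearEquiv.trans (WithLp.linearEquiv 2 ℝ (ι ⊕ ι → ℝ))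

theorem realPi_apply (x : EuclideanSpace ℂ ι) (j : ι ⊕ ι) :
    realPi ι x j = realCoords ι x j := rfl

theorem card_sum_self : Fintype.card (ι ⊕ ι) = 2 * Fintype.card ι := by
  simp [two_mul]

theorem finrank_real : Module.finrank ℝ (EuclideanSpace ℂ ι) = 2 * Fintype.card ι := by
  rw [(realPi ι).finrank_eq, Module.finrank_fintype_fun_eq_card, card_sum_self]

theorem hausdorffMeasure_eq_volume_realPi (s : Set (EuclideanSpace ℂ ι)) :
    (Measure.euclideanHausdorffMeasure (2 * Fintype.card ι) : Measure (EuclideanSpace ℂ ι)) s =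
      volume (realPi ι '' s) := by
  rw [← (realCoords ι).isometry.euclideanHausdorffMeasure_image]
  have h : Module.finrank ℝ (EuclideanSpace ℝ (ι ⊕ ι)) = 2 * Fintype.card ι := by
    rw [finrank_euclideanSpace, card_sum_self]
  rw [← h, InnerProductSpace.euclideanHausdorffMeasure_eq_volume]
  have h2 : realPi ι '' s = (MeasurableEquiv.toLp 2 (ι ⊕ ι → ℝ)).symm '' (realCoords ι '' s) := by
    rw [Set.image_image]; rfl
  rw [h2, MeasurableEquiv.image_symm,
    ← (EuclideanSpace.volume_preserving_symm_measurableEquiv_toLp (ι ⊕ ι)).symm.measure_preimage_equiv]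
  rfl

theorem realPi_image_cube (a : ℝ) :
    realPi ι '' cube ι a = Set.Icc (fun _ => -(a / 2)) (fun _ => a / 2) := by
  ext y
  rw [LinearEquiv.image_eq_preimage_symm, Set.mem_preimage, Set.mem_Icc]
  constructor
  · intro h
    have h' : ∀ i, |y (.inl i)| ≤ a / 2 ∧ |y (.inr i)| ≤ a / 2 := h
    constructor <;> rintro (i | i)
    exacts [(abs_le.1 (h' i).1).1, (abs_le.1 (h' i).2).1, (abs_le.1 (h' i).1).2,
      (abs_le.1 (h' i).2).2]
  · rintro ⟨h1, h2⟩
    have h' : ∀ i, |y (.inl i)| ≤ a / 2 ∧ |y (.inr i)| ≤ a / 2 :=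
      fun i => ⟨abs_le.2 ⟨h1 _, h2 _⟩, abs_le.2 ⟨h1 _, h2 _⟩⟩
    exact h'

theorem hausdorffMeasure_cube {a : ℝ} (ha : 0 ≤ a) :
    (Measure.euclideanHausdorffMeasure (2 * Fintype.card ι) : Measure (EuclideanSpace ℂ ι))
      (cube ι a) = ENNReal.ofReal (a ^ (2 * Fintype.card ι)) := by
  rw [hausdorffMeasure_eq_volume_realPi, realPi_image_cube, Real.volume_Icc_pi]
  simp only [sub_neg_eq_add, add_halves, Finset.prod_const, Finset.card_univ]
  rw [card_sum_self, ENNReal.ofReal_pow ha]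

/-- A complex linear endomorphism multiplies real volumes by the squared modulus of its complex
determinant. -/
theorem hausdorffMeasure_image_linear
    (B : EuclideanSpace ℂ ι →ₗ[ℂ] EuclideanSpace ℂ ι) (s : Set (EuclideanSpace ℂ ι)) :
    (Measure.euclideanHausdorffMeasure (2 * Fintype.card ι) : Measure (EuclideanSpace ℂ ι))
      (B '' s) = ENNReal.ofReal (‖LinearMap.det B‖ ^ 2) *
      (Measure.euclideanHausdorffMeasure (2 * Fintype.card ι) : Measure (EuclideanSpace ℂ ι)) s := by
  have key : ∀ μ : Measure (EuclideanSpace ℂ ι), μ.IsAddHaarMeasure →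
      μ (B '' s) = ENNReal.ofReal (‖LinearMap.det B‖ ^ 2) * μ s := by
    intro μ _
    have h := Measure.addHaar_image_linearMap μ (B.restrictScalars ℝ) s
    rw [LinearMap.det_restrictScalars, Algebra.norm_complex_apply,
      abs_of_nonneg (Complex.normSq_nonneg _), Complex.normSq_eq_norm_sq] at h
    exact h
  refine key _ ?_
  rw [← finrank_real]
  infer_instance

/-! ### Tails of the Gaussian noise -/

instance complexNormal.instIsProbabilityMeasure (v : ℝ≥0) :
    IsProbabilityMeasure (complexNormal v) :=
  Measure.isProbabilityMeasure_map
    (Complex.measurableEquivRealProd.symm.measurable.aemeasurable)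

theorem measurePreserving_complexNormal (v : ℝ≥0) :
    MeasurePreserving Complex.measurableEquivRealProd.symm
      ((gaussianReal 0 (v / 2)).prod (gaussianReal 0 (v / 2))) (complexNormal v) :=
  ⟨Complex.measurableEquivRealProd.symm.measurable, rfl⟩

theorem re_conj_mul_mk (e : ℂ) (p : ℝ × ℝ) :
    Real.exp ((starRingEnd ℂ e * Complex.measurableEquivRealProd.symm p).re) =
      Real.exp (e.re * p.1) * Real.exp (e.im * p.2) := by
  rw [← Real.exp_add]
  congr 1
  simp [Complex.measurableEquivRealProd]

theorem integrable_exp_complexNormal (v : ℝ≥0) (e : ℂ) :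
    Integrable (fun z : ℂ => Real.exp ((starRingEnd ℂ e * z).re)) (complexNormal v) := by
  rw [← (measurePreserving_complexNormal v).integrable_comp_emb
    (MeasurableEquiv.measurableEmbedding _)]
  simp only [Function.comp_def, re_conj_mul_mk]
  exact (integrable_exp_mul_gaussianReal e.re).mul_prod (integrable_exp_mul_gaussianReal e.im)

/-- The real and imaginary parts have variance `v / 2` each, hence the factor `v / 4`. -/
theorem integral_exp_complexNormal (v : ℝ≥0) (e : ℂ) :
    ∫ z, Real.exp ((starRingEnd ℂ e * z).re) ∂complexNormal v =
      Real.exp (v / 4 * ‖e‖ ^ 2) := by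
  have hg : ∀ t : ℝ, ∫ x, Real.exp (t * x) ∂gaussianReal 0 (v / 2) =
      Real.exp ((v / 2 : ℝ≥0) * t ^ 2 / 2) := by
    intro t
    have := congrFun (mgf_fun_id_gaussianReal (μ := 0) (v := v / 2)) t
    simpa [mgf] using this
  rw [← (measurePreserving_complexNormal v).integral_comp
    (MeasurableEquiv.measurableEmbedding _)]
  simp only [re_conj_mul_mk]
  rw [integral_prod_mul (fun x => Real.exp (e.re * x)) (fun x => Real.exp (e.im * x)), hg, hg,
    ← Real.exp_add, Complex.sq_norm, Complex.normSq_apply]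
  congr 1
  push_cast
  ring

/-- The exponential moment of the real part of `⟪e, 𝐧⟫` depends on `e` only through its norm. -/
theorem lintegral_exp_noiseLaw (e : EuclideanSpace ℂ κ) :
    ∫⁻ n, ENNReal.ofReal (Real.exp (inner ℂ e n).re) ∂noiseLaw κ =
      ENNReal.ofReal (Real.exp (1 / (4 * Real.pi * Real.exp 1) * ‖e‖ ^ 2)) := by
  have hprod : ∀ x : κ → ℂ, Real.exp (inner ℂ e (WithLp.toLp 2 x)).re =
      ∏ k, Real.exp ((starRingEnd ℂ (e k) * x k).re) := by
    intro x
    rw [← Real.exp_sum, PiLp.inner_apply, Complex.re_sum]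
    simp [mul_comm]
  rw [noiseLaw, lintegral_map (by fun_prop) (by fun_prop)]
  simp only [hprod]
  rw [← ofReal_integral_eq_lintegral_ofReal
    (Integrable.fintype_prod (fun k => integrable_exp_complexNormal _ (e k)))
    (ae_of_all _ fun x => Finset.prod_nonneg fun k _ => (Real.exp_pos _).le),
    integral_fintype_prod_eq_prod (𝕜 := ℝ)
      (fun k (z : ℂ) => Real.exp ((starRingEnd ℂ (e k) * z).re))]
  simp only [integral_exp_complexNormal]
  rw [← Real.exp_sum, ← Finset.mul_sum, EuclideanSpace.norm_sq_eq,
    Real.coe_toNNReal _ (by positivity)]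
  congr 3
  field_simp

theorem noiseLaw_le_inner (m : ℕ) {s : ℝ} (hs : 0 < s) {e : EuclideanSpace ℂ κ} (he : ‖e‖ = 1) :
    noiseLaw κ {n | s ≤ (inner ℂ e n).re} ≤
      ENNReal.ofReal (Real.exp 1 * m.factorial / s ^ m) := by
  have hsub : {n : EuclideanSpace ℂ κ | s ≤ (inner ℂ e n).re} ⊆
      {n | ENNReal.ofReal (s ^ m / m.factorial) ≤
        ENNReal.ofReal (Real.exp (inner ℂ e n).re)} := by
    intro n hn
    refine ENNReal.ofReal_le_ofReal ?_
    calc s ^ m / m.factorial ≤ (inner ℂ e n).re ^ m / m.factorial := by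
          gcongr; exact hn
      _ ≤ _ := Real.pow_div_factorial_le_exp _ (hs.le.trans hn) m
  refine (measure_mono hsub).trans ((meas_ge_le_lintegral_div (by fun_prop)
    (by simp; positivity) ENNReal.ofReal_ne_top).trans ?_)
  rw [lintegral_exp_noiseLaw, he, ← ENNReal.ofReal_div_of_pos (by positivity)]
  refine ENNReal.ofReal_le_ofReal ?_
  have h1 : (1 : ℝ) ≤ 4 * Real.pi * Real.exp 1 := by
    have := Real.pi_gt_three
    have := Real.add_one_le_exp 1
    nlinarith
  rw [div_div_eq_mul_div]
  gcongr
  rw [one_pow, mul_one]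
  exact (div_le_one (by positivity)).2 h1

theorem noiseLaw_le_abs_inner (m : ℕ) {s : ℝ} (hs : 0 < s) {e : EuclideanSpace ℂ κ}
    (he : ‖e‖ = 1) :
    noiseLaw κ {n | s ≤ |(inner ℂ e n).re|} ≤
      ENNReal.ofReal (2 * (Real.exp 1 * m.factorial / s ^ m)) := by
  have hsub : {n : EuclideanSpace ℂ κ | s ≤ |(inner ℂ e n).re|} ⊆
      {n | s ≤ (inner ℂ e n).re} ∪ {n | s ≤ (inner ℂ (-e) n).re} := by
    intro n hn
    simpa [le_abs] using hn
  refine (measure_mono hsub).trans ((measure_union_le _ _).trans ?_)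
  rw [two_mul, ENNReal.ofReal_add (by positivity) (by positivity)]
  exact add_le_add (noiseLaw_le_inner m hs he) (noiseLaw_le_inner m hs (by rwa [norm_neg]))

/-- Every real coordinate of `U* n` is the real part of the inner product of `n` with a fixed unit
vector: the image under `U` of `eᵢ` for a real part, and of `i eᵢ` for an imaginary part. -/
theorem exists_realCoords_adjoint (U : EuclideanSpace ℂ ι →ₗᵢ[ℂ] EuclideanSpace ℂ κ)
    (j : ι ⊕ ι) : ∃ e : EuclideanSpace ℂ κ, ‖e‖ = 1 ∧ ∀ n,
      realCoords ι (LinearMap.adjoint U.toLinearMap n) j = (inner ℂ e n).re := by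
  classical
  rcases j with i | i
  · refine ⟨U (EuclideanSpace.single i 1), by simp, fun n => ?_⟩
    have := LinearMap.adjoint_inner_right U.toLinearMap (EuclideanSpace.single i 1) n
    simp only [LinearIsometry.coe_toLinearMap] at this
    rw [← this]
    simp [EuclideanSpace.inner_single_left]
  · refine ⟨U (EuclideanSpace.single i Complex.I), by simp, fun n => ?_⟩
    have := LinearMap.adjoint_inner_right U.toLinearMap (EuclideanSpace.single i Complex.I) n
    simp only [LinearIsometry.coe_toLinearMap] at this
    rw [← this]
    simp [EuclideanSpace.inner_single_left]

/-- If the norm of a vector with `2n` real coordinates is at least `√(2n) s`, some coordinate has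
absolute value at least `s`; the union bound over the coordinates gives the estimate. -/
theorem noiseLaw_adjoint_norm_le [Nonempty ι]
    (U : EuclideanSpace ℂ ι →ₗᵢ[ℂ] EuclideanSpace ℂ κ) (m : ℕ) {s : ℝ} (hs : 0 < s) :
    noiseLaw κ {n | √(2 * Fintype.card ι) * s ≤ ‖LinearMap.adjoint U.toLinearMap n‖} ≤
      ENNReal.ofReal (2 * Fintype.card ι * (2 * (Real.exp 1 * m.factorial / s ^ m))) := by
  choose e he hinner using exists_realCoords_adjoint U
  have hsub : {n | √(2 * Fintype.card ι) * s ≤ ‖LinearMap.adjoint U.toLinearMap n‖} ⊆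
      ⋃ j, {n | s ≤ |(inner ℂ (e j) n).re|} := by
    intro n hn
    simp only [Set.mem_iUnion, Set.mem_ofPred_eq, ← hinner] at hn ⊢
    by_contra! hcon
    refine absurd hn (not_le.2 ?_)
    rw [← (realCoords ι).norm_map, EuclideanSpace.norm_eq]
    calc √(∑ j, ‖realCoords ι (LinearMap.adjoint U.toLinearMap n) j‖ ^ 2)
        < √(∑ _j : ι ⊕ ι, s ^ 2) := by
          refine Real.sqrt_lt_sqrt (by positivity) (Finset.sum_lt_sum_of_nonempty
            Finset.univ_nonempty fun j _ => ?_)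
          exact pow_lt_pow_left₀ (hcon j) (abs_nonneg _) two_ne_zero
      _ = √(2 * Fintype.card ι) * s := by
          rw [Finset.sum_const, Finset.card_univ, card_sum_self, nsmul_eq_mul,
            Real.sqrt_mul (by positivity), Real.sqrt_sq hs.le]
          push_cast
          rfl
  refine (measure_mono hsub).trans ((measure_iUnion_fintype_le _ _).trans
    ((Finset.sum_le_sum fun j _ => noiseLaw_le_abs_inner m hs (he j)).trans ?_))
  rw [Finset.sum_const, Finset.card_univ, card_sum_self, nsmul_eq_mul,
    ENNReal.ofReal_mul (p := 2 * (Fintype.card ι : ℝ)) (by positivity)]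
  refine mul_le_mul_left (le_of_eq ?_) _
  rw [← ENNReal.ofReal_natCast]
  push_cast
  rfl

/-! ### Factorization and determinant of the channel -/

/-- An injective linear map is an automorphism of its domain followed by an isometric embedding;
the automorphism carries the norm determinant. -/
theorem exists_isometry_comp (f : EuclideanSpace ℂ ι →ₗ[ℂ] EuclideanSpace ℂ κ)
    (hf : Function.Injective f) :
    ∃ (U : EuclideanSpace ℂ ι →ₗᵢ[ℂ] EuclideanSpace ℂ κ)
      (B : EuclideanSpace ℂ ι ≃ₗ[ℂ] EuclideanSpace ℂ ι),
      f = U.toLinearMap ∘ₗ B.toLinearMap ∧ ‖LinearMap.det B.toLinearMap‖ = f.normDet := by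
  have hr : Module.finrank ℂ (LinearMap.range f) = Fintype.card ι := by
    rw [LinearMap.finrank_range_of_inj hf, finrank_euclideanSpace]
  let b := (stdOrthonormalBasis ℂ (LinearMap.range f)).reindex
    (Fintype.equivOfCardEq (by simp [hr]) : Fin (Module.finrank ℂ (LinearMap.range f)) ≃ ι)
  let U := (LinearMap.range f).subtypeₗᵢ.comp b.repr.symm.toLinearIsometry
  let B := (LinearEquiv.ofInjective f hf).trans b.repr.toLinearEquiv
  have hUB : f = U.toLinearMap ∘ₗ B.toLinearMap := by
    ext x : 1
    simp [U, B]
  refine ⟨U, B, hUB, ?_⟩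
  have h := LinearMap.normDet_comp_of_finrank_eq B.toLinearMap U.toLinearMap rfl
  rw [← hUB, LinearIsometry.normDet_eq_one, one_mul, LinearMap.normDet_eq_norm_det] at h
  exact h.symm

omit [Fintype κ] in
theorem injective_of_rank_eq [DecidableEq ι] {A : Matrix κ ι ℂ} (hA : A.rank = Fintype.card ι) :
    Function.Injective (Matrix.toEuclideanLin A) := by
  have h := LinearMap.finrank_range_add_finrank_ker A.mulVecLin
  rw [← Matrix.rank, hA, Module.finrank_fintype_fun_eq_card, Nat.add_eq_left,
    Submodule.finrank_eq_zero, LinearMap.ker_eq_bot] at h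
  intro x y hxy
  refine WithLp.ofLp_injective 2 (h ?_)
  exact congrArg WithLp.ofLp hxy

theorem normDet_sq_eq_det [DecidableEq ι] (A : Matrix κ ι ℂ) :
    (Matrix.toEuclideanLin A).normDet ^ 2 = (A.conjTranspose * A).det.re := by
  have h := LinearMap.normDet_sq_eq_det_gram (Matrix.toEuclideanLin A)
    (EuclideanSpace.basisFun ι ℂ)
  have hg : Matrix.gram ℂ (fun i => Matrix.toEuclideanLin A (EuclideanSpace.basisFun ι ℂ i)) =
      A.conjTranspose * A := by
    ext i j
    simp [Matrix.gram, PiLp.inner_apply, Matrix.mul_apply, mul_comm]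
  rw [hg] at h
  rw [← h]
  exact (Complex.ofReal_re _).symm

/-! ### Lattices that are cubic at the receiver -/

/-- The lattice `B⁻¹ (d ℤ[i]^ι)`: the points whose images under `B` have all their real and
imaginary parts in `d ℤ`. -/
def latticeConstellation (B : EuclideanSpace ℂ ι ≃ₗ[ℂ] EuclideanSpace ℂ ι) (d : ℝ) :
    Set (EuclideanSpace ℂ ι) :=
  {x | ∀ j, ∃ k : ℤ, realCoords ι (B x) j = d * k}

variable {B : EuclideanSpace ℂ ι ≃ₗ[ℂ] EuclideanSpace ℂ ι} {d ρ : ℝ}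

theorem isConstellation_lattice [DecidableEq ι] (hd : 0 < d) :
    IsConstellation (latticeConstellation B d) := by
  constructor
  · refine (Set.countable_range fun k : ι ⊕ ι → ℤ =>
      B.symm ((realCoords ι).symm (WithLp.toLp 2 fun j => d * k j))).mono ?_
    intro x hx
    choose k hk using hx
    refine ⟨k, ?_⟩
    rw [LinearEquiv.symm_apply_eq, LinearIsometryEquiv.symm_apply_eq]
    ext j
    exact (hk j).symm
  · have hmem : ∀ i, B.symm (EuclideanSpace.single i (d : ℂ)) ∈ latticeConstellation B d := by
      rintro i (j | j)
      · refine ⟨if j = i then 1 else 0, ?_⟩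
        rw [LinearEquiv.apply_symm_apply, realCoords_inl, PiLp.single_apply]
        split_ifs <;> simp
      · refine ⟨0, ?_⟩
        rw [LinearEquiv.apply_symm_apply, realCoords_inr, PiLp.single_apply]
        split_ifs <;> simp
    have htop : Submodule.span ℂ (latticeConstellation B d) = ⊤ := by
      refine eq_top_iff.2 fun x _ => ?_
      have hx : x = ∑ i, ((d : ℂ)⁻¹ * B x i) • B.symm (EuclideanSpace.single i (d : ℂ)) := by
        apply B.injective
        simp only [map_sum, map_smul, LinearEquiv.apply_symm_apply]
        ext j
        have : (d : ℂ) ≠ 0 := by exact_mod_cast hd.ne'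
        simp [Pi.single_apply, mul_right_comm _ _ (d : ℂ), this]
      rw [hx]
      exact Submodule.sum_mem _ fun i _ => Submodule.smul_mem _ _ (Submodule.subset_span (hmem i))
    rw [htop, finrank_top, finrank_euclideanSpace]

omit [Fintype ι] in
theorem smul_cube {a : ℝ} (ha : 0 < a) (x : EuclideanSpace ℂ ι) :
    a • x ∈ cube ι a ↔ x ∈ cube ι 1 := by
  have h : ∀ t : ℝ, |a * t| ≤ a / 2 ↔ |t| ≤ 1 / 2 := by
    intro t
    rw [abs_mul, abs_of_pos ha, show a / 2 = a * (1 / 2) by ring, mul_le_mul_iff_right₀ ha]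
  simp only [cube, Set.mem_ofPred_eq, PiLp.smul_apply, Complex.smul_re, Complex.smul_im,
    smul_eq_mul, h]

open scoped Pointwise in
/-- The lattice `B⁻¹ (d ℤ[i]^ι)` has `|det B|² / d ^ (2n)` points per unit of volume. -/
theorem tendsto_numPoints_lattice (hd : 0 < d) :
    Tendsto (fun a : ℝ => numPoints (latticeConstellation B d) a /
      ENNReal.ofReal (a ^ (2 * Fintype.card ι))) atTop
      (nhds (ENNReal.ofReal (‖LinearMap.det B.toLinearMap‖ ^ 2 / d ^ (2 * Fintype.card ι)))) := by
  have hdc : (d : ℂ)⁻¹ ≠ 0 := inv_ne_zero (by exact_mod_cast hd.ne')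
  let C : EuclideanSpace ℂ ι ≃ₗ[ℂ] EuclideanSpace ℂ ι :=
    B.trans (LinearEquiv.smulOfNeZero ℂ _ (d : ℂ)⁻¹ hdc)
  -- In the coordinates `Φ` the lattice is `ℤ^(ι ⊕ ι)` and the unit cube is a convex body `s`.
  let Φ : EuclideanSpace ℂ ι ≃ₗ[ℝ] (ι ⊕ ι → ℝ) := (C.restrictScalars ℝ).trans (realPi ι)
  let L : Submodule ℤ (ι ⊕ ι → ℝ) := Submodule.span ℤ (Set.range (Pi.basisFun ℝ (ι ⊕ ι)))
  let s : Set (ι ⊕ ι → ℝ) := Φ '' cube ι 1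
  have hΦ : ∀ x j, realCoords ι (B x) j = d * Φ x j := by
    intro x j
    have : Φ x j = d⁻¹ * realCoords ι (B x) j := by
      rcases j with j | j <;> simp [Φ, C, realPi_apply, ← Complex.ofReal_inv]
    rw [this]
    field_simp
  have hS : ∀ x, x ∈ latticeConstellation B d ↔ Φ x ∈ L := by
    intro x
    simp only [L, Module.Basis.mem_span_iff_repr_mem, latticeConstellation, hΦ, Set.mem_ofPred_eq,
      mul_right_inj' hd.ne', Pi.basisFun_repr, Set.mem_range, algebraMap_int_eq, eq_intCast, eq_comm]
  have hconv1 : Convex ℝ (cube ι 1) := by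
    have : cube ι 1 = (realPi ι) ⁻¹' Set.Icc (fun _ => -(1 / 2)) (fun _ => 1 / 2) := by
      rw [← realPi_image_cube, (realPi ι).injective.preimage_image]
    rw [this]
    exact (convex_Icc _ _).linear_preimage (realPi ι).toLinearMap
  have hconv : Convex ℝ s := hconv1.linear_image Φ.toLinearMap
  have hcomp : IsCompact s := by
    have : cube ι 1 = (realPi ι).symm '' Set.Icc (fun _ => -(1 / 2)) (fun _ => 1 / 2) := by
      rw [← realPi_image_cube, Set.image_image]; simp
    have h1 : IsCompact (cube ι 1) := by
      rw [this]
      exact isCompact_Icc.image (LinearMap.continuous_of_finiteDimensional (realPi ι).symm.toLinearMap)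
    exact h1.image (LinearMap.continuous_of_finiteDimensional Φ.toLinearMap)
  have h0 : (0 : ι ⊕ ι → ℝ) ∈ s := ⟨0, by simp [cube], map_zero _⟩
  have hvol : volume.real s = ‖LinearMap.det B.toLinearMap‖ ^ 2 / d ^ (2 * Fintype.card ι) := by
    have h1 : s = realPi ι '' (C.toLinearMap '' cube ι 1) := by
      rw [Set.image_image]; rfl
    have h2 : C.toLinearMap = (d : ℂ)⁻¹ • B.toLinearMap := rfl
    rw [Measure.real, h1, ← hausdorffMeasure_eq_volume_realPi, hausdorffMeasure_image_linear,
      hausdorffMeasure_cube zero_le_one, h2, LinearMap.det_smul, finrank_euclideanSpace,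
      one_pow, ENNReal.ofReal_one, mul_one, ENNReal.toReal_ofReal (by positivity), norm_mul,
      norm_pow, norm_inv, Complex.norm_real, Real.norm_of_nonneg hd.le, mul_pow, ← pow_mul,
      mul_comm _ 2, inv_pow, div_eq_inv_mul]
  -- A convex body has a null frontier, and as it contains `0` its dilates increase.
  have key := tendsto_card_div_pow_atTop_volume' s hcomp.isBounded hcomp.measurableSet
    (hconv.addHaar_frontier _) (by
      intro x y hx hxy
      rintro _ ⟨z, hz, rfl⟩
      have hy := hx.trans_le hxy
      refine ⟨(x / y) • z, ?_, ?_⟩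
      · exact hconv.smul_mem_of_zero_mem h0 hz ⟨by positivity, (div_le_one hy).2 hxy⟩
      · simp only [smul_smul]
        rw [mul_div_cancel₀ _ hy.ne'])
  rw [hvol, card_sum_self] at key
  refine (ENNReal.tendsto_ofReal key).congr' ?_
  filter_upwards [eventually_gt_atTop 0] with a ha
  have hset : latticeConstellation B d ∩ cube ι a =
      (fun z => Φ.symm (a • z)) '' (s ∩ a⁻¹ • (L : Set (ι ⊕ ι → ℝ))) := by
    ext x
    constructor
    · rintro ⟨hx, hc⟩
      refine ⟨a⁻¹ • Φ x, ⟨⟨a⁻¹ • x, ?_, by simp⟩, Set.smul_mem_smul_set ((hS x).1 hx)⟩, ?_⟩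
      · rw [← smul_cube ha, smul_inv_smul₀ ha.ne']; exact hc
      · simp [smul_inv_smul₀ ha.ne']
    · rintro ⟨z, ⟨⟨y, hy, rfl⟩, hz⟩, rfl⟩
      rw [Set.mem_inv_smul_set_iff₀ ha.ne'] at hz
      refine ⟨(hS _).2 (by simpa using hz), ?_⟩
      simpa [smul_cube ha] using hy
  have hinj : Function.Injective (fun z => Φ.symm (a • z)) :=
    Φ.symm.injective.comp (smul_right_injective _ ha.ne')
  have hfin : (s ∩ a⁻¹ • (L : Set (ι ⊕ ι → ℝ))).Finite := by
    have : (a • s ∩ (L : Set (ι ⊕ ι → ℝ))).Finite := ZSpan.setFinite_inter _ (hcomp.isBounded.smul₀ a)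
    refine (this.preimage (f := fun z => a • z) (smul_right_injective _ ha.ne').injOn).subset ?_
    rintro z ⟨h1, h2⟩
    exact ⟨Set.smul_mem_smul_set h1, (Set.mem_inv_smul_set_iff₀ ha.ne' _ _).1 h2⟩
  rw [numPoints, hset, hinj.encard_image, ← hfin.cast_ncard_eq,
    ENNReal.ofReal_div_of_pos (by positivity), ENNReal.ofReal_natCast]
  rfl

/-! ### Decoding errors -/

/-- Distinct points are at distance at least `d` after `B`: some coordinate of the difference is a
nonzero integer multiple of `d`. -/
theorem le_norm_sub_of_mem_lattice (hd : 0 < d) {x y : EuclideanSpace ℂ ι}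
    (hx : x ∈ latticeConstellation B d) (hy : y ∈ latticeConstellation B d) (hxy : x ≠ y) :
    d ≤ ‖B (x - y)‖ := by
  have hne : realCoords ι (B x) ≠ realCoords ι (B y) := fun h =>
    hxy (B.injective ((realCoords ι).injective h))
  obtain ⟨j, hj⟩ : ∃ j, realCoords ι (B x) j ≠ realCoords ι (B y) j := by
    by_contra! h
    exact hne (PiLp.ext h)
  obtain ⟨k, hk⟩ := hx j
  obtain ⟨k', hk'⟩ := hy j
  have hkk : k - k' ≠ 0 := by
    intro h
    rw [hk, hk', sub_eq_zero.1 h] at hj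
    exact hj rfl
  have h1 : (1 : ℝ) ≤ |((k - k' : ℤ) : ℝ)| := by exact_mod_cast Int.one_le_abs hkk
  calc d ≤ d * |((k - k' : ℤ) : ℝ)| := le_mul_of_one_le_right hd.le h1
    _ = ‖realCoords ι (B (x - y)) j‖ := by
      rw [map_sub, map_sub, PiLp.sub_apply, hk, hk', ← mul_sub, Real.norm_eq_abs, abs_mul,
        abs_of_pos hd]
      push_cast
      rfl
    _ ≤ ‖realCoords ι (B (x - y))‖ := PiLp.norm_apply_le _ j
    _ = _ := (realCoords ι).norm_map _

/-- A noise vector `w` that is at least as close to `U b` as to `0` has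
`‖b‖² ≤ 2 Re ⟪b, U* w⟫`, so its component in the range of `U` has norm at least `‖b‖ / 2`. -/
theorem norm_le_of_norm_sub_le (U : EuclideanSpace ℂ ι →ₗᵢ[ℂ] EuclideanSpace ℂ κ)
    {b : EuclideanSpace ℂ ι} {w : EuclideanSpace ℂ κ} (h : ‖w - U b‖ ≤ ‖w‖) :
    ‖b‖ ≤ 2 * ‖LinearMap.adjoint U.toLinearMap w‖ := by
  have h1 := norm_sub_sq (𝕜 := ℂ) w (U b)
  have h2 : ‖w - U b‖ ^ 2 ≤ ‖w‖ ^ 2 := by gcongr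
  have h3 : RCLike.re (inner ℂ w (U b)) ≤ ‖LinearMap.adjoint U.toLinearMap w‖ * ‖b‖ := by
    have := LinearMap.adjoint_inner_left U.toLinearMap b w
    rw [LinearIsometry.coe_toLinearMap] at this
    rw [← this]
    exact re_inner_le_norm _ _
  rw [U.norm_map] at h1
  have h4 : ‖b‖ * ‖b‖ ≤ 2 * ‖LinearMap.adjoint U.toLinearMap w‖ * ‖b‖ := by nlinarith
  rcases (norm_nonneg b).eq_or_lt with h0 | h0
  · rw [← h0]; positivity
  · exact le_of_mul_le_mul_right h4 h0

/-- The constant `D(n)`: a union bound over `2n` real coordinates with two signs each, the moment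
bound `e (2n)!`, and `(8n)ⁿ` from splitting the radius `√ρ d / 2` among the coordinates. The
summand `1` keeps it positive for `n = 0`. -/
noncomputable def errorConstant (n : ℕ) : ℝ :=
  2 * n * (2 * (Real.exp 1 * (2 * n).factorial)) * (8 * n) ^ n + 1

theorem errorConstant_pos (n : ℕ) : 0 < errorConstant n := by
  unfold errorConstant; positivity

variable {A : Matrix κ ι ℂ} {U : EuclideanSpace ℂ ι →ₗᵢ[ℂ] EuclideanSpace ℂ κ}

theorem pointError_le [DecidableEq ι] [Nonempty ι]
    (hA : ∀ x, Matrix.toEuclideanLin A x = U (B x)) (hd : 0 < d)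
    (hρ : 0 < ρ) {x : EuclideanSpace ℂ κ}
    (hx : x ∈ throughChannel A (latticeConstellation B d)) :
    pointError (throughChannel A (latticeConstellation B d)) ρ x ≤
      ENNReal.ofReal (errorConstant (Fintype.card ι) /
        (d ^ (2 * Fintype.card ι) * ρ ^ Fintype.card ι)) := by
  obtain ⟨x, hx, rfl⟩ := hx
  set n := Fintype.card ι with hn
  have hn0 : 0 < n := Fintype.card_pos
  -- `√(2n) s = √ρ d / 2` is the radius that the noise has to reach.
  set s : ℝ := d * √ρ / (2 * √(2 * n)) with hs
  have hs0 : 0 < s := by positivity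
  have hsub : {w | Matrix.toEuclideanLin A x + (ρ ^ (-(1 / 2) : ℝ) : ℝ) • w ∉
      voronoiRegion (throughChannel A (latticeConstellation B d)) (Matrix.toEuclideanLin A x)} ⊆
      {w | √(2 * n) * s ≤ ‖LinearMap.adjoint U.toLinearMap w‖} := by
    intro w hw
    simp only [voronoiRegion, Set.mem_ofPred_eq, not_forall, not_lt, exists_prop] at hw
    obtain ⟨_, ⟨y, hy, rfl⟩, hne, hdist⟩ := hw
    have hyx : y ≠ x := fun h => hne (by rw [h])
    have hc : (ρ ^ (-(1 / 2) : ℝ) : ℝ) = (√ρ)⁻¹ := by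
      rw [Real.rpow_neg hρ.le, Real.sqrt_eq_rpow]
    rw [dist_eq_norm, dist_eq_norm, add_sub_cancel_left, hc,
      show Matrix.toEuclideanLin A x + (√ρ)⁻¹ • w - Matrix.toEuclideanLin A y =
        (√ρ)⁻¹ • w - U (B (y - x)) by rw [← hA, map_sub]; abel] at hdist
    have h1 := (le_norm_sub_of_mem_lattice hd hy hx hyx).trans (norm_le_of_norm_sub_le U hdist)
    rw [LinearMap.map_smul_of_tower, norm_smul, Real.norm_of_nonneg (by positivity)] at h1
    have h2 : √(2 * n) * s = d * √ρ / 2 := by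
      rw [hs]; field_simp
    rw [Set.mem_ofPred_eq, h2]
    have h3 := Real.sqrt_pos.2 hρ
    field_simp at h1
    linarith
  refine (measure_mono hsub).trans ((noiseLaw_adjoint_norm_le U (2 * n) hs0).trans
    (ENNReal.ofReal_le_ofReal ?_))
  have h4 : s ^ (2 * n) = d ^ (2 * n) * ρ ^ n / (8 * n) ^ n := by
    rw [pow_mul, pow_mul, ← mul_pow, ← div_pow, hs, div_pow, mul_pow, mul_pow,
      Real.sq_sqrt hρ.le, Real.sq_sqrt (by positivity)]
    congr 2
    ring
  rw [h4, ← hn]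
  have h5 : 2 * (n : ℝ) * (2 * (Real.exp 1 * (2 * n).factorial /
      (d ^ (2 * n) * ρ ^ n / (8 * n) ^ n))) =
      2 * n * (2 * (Real.exp 1 * (2 * n).factorial)) * (8 * n) ^ n / (d ^ (2 * n) * ρ ^ n) := by
    field_simp
  rw [h5, errorConstant]
  gcongr
  linarith

/-- For an injective channel the average error probability is an average over exactly `M(S, a)`
points. If the cube contains no point, the quotient is `0 / 0 = 0`. -/
theorem avgError_le_of_pointError_le [DecidableEq ι]
    (hA : Function.Injective (Matrix.toEuclideanLin A))
    {S : Set (EuclideanSpace ℂ ι)} {c : ℝ≥0∞}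
    (h : ∀ x ∈ throughChannel A S, pointError (throughChannel A S) ρ x ≤ c) :
    avgError A S ρ ≤ c := by
  refine limsup_le_of_le (by isBoundedDefault) (Eventually.of_forall fun a => ?_)
  refine ENNReal.div_le_of_le_mul ?_
  refine (ENNReal.tsum_le_tsum fun x => h _ x.2.1).trans ?_
  have hc : (throughChannel A S ∩ throughChannel A (cube ι a)).encard = (S ∩ cube ι a).encard := by
    rw [throughChannel, throughChannel, ← Set.image_inter hA, hA.encard_image]
  rw [ENNReal.tsum_const, mul_comm, numPoints, ← hc]
  rfl

/-! ### Densities -/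

theorem txDensity_lattice (hd : 0 < d) : txDensity (latticeConstellation B d) =
    ENNReal.ofReal (‖LinearMap.det B.toLinearMap‖ ^ 2 / d ^ (2 * Fintype.card ι)) :=
  (tendsto_numPoints_lattice hd).limsup_eq

theorem rxDensity_lattice [DecidableEq ι] (hA : ∀ x, Matrix.toEuclideanLin A x = U (B x))
    (hd : 0 < d) :
    rxDensity A (latticeConstellation B d) =
      ENNReal.ofReal (1 / d ^ (2 * Fintype.card ι)) := by
  have hdet : 0 < ‖LinearMap.det B.toLinearMap‖ ^ 2 := by
    have : LinearMap.det B.toLinearMap ≠ 0 := (LinearEquiv.isUnit_det' B).ne_zero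
    positivity
  have h := ENNReal.Tendsto.div_const (tendsto_numPoints_lattice (B := B) hd)
    (b := ENNReal.ofReal (‖LinearMap.det B.toLinearMap‖ ^ 2))
    (Or.inr (ENNReal.ofReal_pos.2 hdet).ne')
  rw [← ENNReal.ofReal_div_of_pos hdet, div_right_comm, div_self hdet.ne'] at h
  refine (h.congr' ?_).limsup_eq
  filter_upwards [eventually_ge_atTop 0] with a ha
  have him : throughChannel A (cube ι a) = U '' (B.toLinearMap '' cube ι a) := by
    rw [throughChannel, Set.image_image]
    exact Set.image_congr fun x _ => hA x
  rw [him, U.isometry.euclideanHausdorffMeasure_image, hausdorffMeasure_image_linear,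
    hausdorffMeasure_cube ha,
    mul_comm (ENNReal.ofReal (‖_‖ ^ 2)), div_eq_mul_inv, div_eq_mul_inv, div_eq_mul_inv,
    ENNReal.mul_inv (Or.inr ENNReal.ofReal_ne_top) (Or.inl ENNReal.ofReal_ne_top), mul_assoc]

/-- The product of the squared singular values. Injectivity makes them positive, so that no
logarithm in `singularExponent` is a junk value. -/
theorem rpow_neg_sum_singularExponent [DecidableEq ι] (hρ : 1 < ρ)
    (hA : Function.Injective (Matrix.toEuclideanLin A)) :
    ρ ^ (-∑ i ∈ Finset.range (Fintype.card ι), singularExponent A ρ i) =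
      (Matrix.toEuclideanLin A).normDet ^ 2 := by
  have hfin : Module.finrank ℂ (EuclideanSpace ℂ ι) = Fintype.card ι := finrank_euclideanSpace
  rw [LinearMap.normDet_eq_prod_singularValues, hfin, ← Finset.prod_pow,
    ← Finset.sum_neg_distrib, Real.rpow_sum_of_pos (by linarith)]
  refine Finset.prod_congr rfl fun i hi => ?_
  have hpos : 0 < (Matrix.toEuclideanLin A).singularValues i :=
    LinearMap.injective_iff_forall_lt_finrank_singularValues_pos _ |>.1 hA i
      (by rw [hfin]; exact Finset.mem_range.1 hi)
  rw [singularExponent, show -(-2 * Real.logb ρ ((Matrix.toEuclideanLin A).singularValues i)) =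
    Real.logb ρ ((Matrix.toEuclideanLin A).singularValues i) * (2 : ℕ) by push_cast; ring,
    Real.rpow_mul (by linarith), Real.rpow_logb (by linarith) hρ.ne' hpos, Real.rpow_natCast]

end Lattice

/-! ### Constellations for a given channel -/

/-- Constellations of any transmitter density `γ`, for any channel of full column rank. -/
theorem exists_constellation {ι κ : Type*} [Fintype ι] [DecidableEq ι] [Nonempty ι] [Fintype κ]
    {A : Matrix κ ι ℂ} (hA : A.rank = Fintype.card ι) {γ ρ : ℝ} (hγ : 0 < γ) (hρ : 0 < ρ) :
    ∃ S : Set (EuclideanSpace ℂ ι), IsConstellation S ∧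
      txDensity S = ENNReal.ofReal γ ∧
      rxDensity A S = ENNReal.ofReal (γ / (Matrix.toEuclideanLin A).normDet ^ 2) ∧
      avgError A S ρ ≤ ENNReal.ofReal (errorConstant (Fintype.card ι) *
        (γ / (Matrix.toEuclideanLin A).normDet ^ 2) / ρ ^ Fintype.card ι) := by
  have hinj := injective_of_rank_eq hA
  obtain ⟨U, B, hUB, hdet⟩ := exists_isometry_comp _ hinj
  have hA' : ∀ x, Matrix.toEuclideanLin A x = U (B x) := fun x => by rw [hUB]; rfl
  set n := Fintype.card ι with hn
  have hn0 : 0 < n := Fintype.card_pos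
  have hdet0 : 0 < (Matrix.toEuclideanLin A).normDet ^ 2 := by
    have : LinearMap.det B.toLinearMap ≠ 0 := (LinearEquiv.isUnit_det' B).ne_zero
    rw [← hdet]
    positivity
  -- `v` is the volume of a cell of the received lattice, and `v ^ (1 / 2n)` its edge.
  set v : ℝ := (Matrix.toEuclideanLin A).normDet ^ 2 / γ with hv
  have hv0 : 0 < v := by positivity
  have hd : 0 < v ^ ((2 * n : ℕ) : ℝ)⁻¹ := Real.rpow_pos_of_pos hv0 _
  have hdn : (v ^ ((2 * n : ℕ) : ℝ)⁻¹) ^ (2 * n) = v :=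
    Real.rpow_inv_natCast_pow hv0.le (by positivity)
  refine ⟨latticeConstellation B (v ^ ((2 * n : ℕ) : ℝ)⁻¹), isConstellation_lattice hd, ?_, ?_, ?_⟩
  · rw [txDensity_lattice hd, hdn, hdet, hv, div_div_cancel₀ hdet0.ne']
  · rw [rxDensity_lattice hA' hd, hdn, hv, one_div_div]
  · refine avgError_le_of_pointError_le hinj fun x hx => (pointError_le hA' hd hρ hx).trans_eq ?_
    rw [hdn, hv]
    congr 1
    rw [← hn]
    field_simp

/-- The noise variance cancels the factor `2πe`, and `rxVNR` is `ρ` times `γ_rc ^ (-1 / n)`. -/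
theorem rxVNR_eq {ι κ : Type*} [Fintype ι] [DecidableEq ι] [Fintype κ]
    {A : Matrix κ ι ℂ} {S : Set (EuclideanSpace ℂ ι)} {ρ t : ℝ} (hρ : 0 < ρ)
    (h : rxDensity A S = ENNReal.ofReal (ρ ^ t)) :
    rxVNR A S ρ = ENNReal.ofReal (ρ ^ (1 - t / Fintype.card ι)) := by
  have h1 : 2 * Real.pi * Real.exp 1 * noiseVariance ρ = ρ⁻¹ := by
    rw [noiseVariance]; field_simp
  rw [rxVNR, h, h1, ENNReal.ofReal_rpow_of_pos (by positivity), ← Real.rpow_mul hρ.le,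
    ← ENNReal.ofReal_div_of_pos (by positivity), div_inv_eq_mul, ← Real.rpow_add_one hρ.ne']
  congr 2
  ring

end MIMO

theorem theorem3 :
    ∃ D : ℕ → ℝ, (∀ n, 0 < D n) ∧
      ∀ (M N l : ℕ), l < min M N →
      ∀ (r : ℝ) (H : Matrix (Fin N) (Fin M) ℂ),
        (MIMO.effectiveChannel l H).rank = Fintype.card (MIMO.SymbolIndex M N l) →
        ∃ S : ℝ → Set (EuclideanSpace ℂ (MIMO.SymbolIndex M N l)),
          ∀ ρ : ℝ, 1 < ρ →
            let A := MIMO.effectiveChannel l H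
            let n := Fintype.card (MIMO.SymbolIndex M N l)
            let T : ℝ := (MIMO.channelUses M N l : ℝ)
            let K : ℝ := MIMO.dimPerUse M N l
            let sumEta : ℝ := ∑ i ∈ Finset.range n, MIMO.singularExponent A ρ i
            (n : ℝ) = K * T ∧
            MIMO.IsConstellation (S ρ) ∧
            MIMO.txDensity (S ρ) = ENNReal.ofReal (ρ ^ (r * T)) ∧
            MIMO.rxVNR A (S ρ) ρ = ENNReal.ofReal (ρ ^ (1 - r / K - sumEta / (K * T))) ∧
            MIMO.avgError A (S ρ) ρ ≤ ENNReal.ofReal (D n * ρ ^ (-T * (K - r) + sumEta)) ∧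
            D n * ρ ^ (-T * (K - r) + sumEta) =
              D n * ρ ^ (-T * (K - r)) * ((A.conjTranspose * A).det.re)⁻¹ := by
  refine ⟨MIMO.errorConstant, MIMO.errorConstant_pos, fun M N l hl r H hrank => ?_⟩
  have hcard := MIMO.card_symbolIndex hl
  have hT : 0 < (MIMO.channelUses M N l : ℝ) := by
    exact_mod_cast (by simp only [MIMO.channelUses]; omega : 0 < MIMO.channelUses M N l)
  have hK : 0 < MIMO.dimPerUse M N l := by
    have hM : (l : ℝ) + 1 ≤ M := by exact_mod_cast (lt_min_iff.1 hl).1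
    have hN : (l : ℝ) + 1 ≤ N := by exact_mod_cast (lt_min_iff.1 hl).2
    have h1 : 0 < ((M : ℝ) - l) * ((N : ℝ) - l) := mul_pos (by linarith) (by linarith)
    have h2 : 0 < (N : ℝ) + M - 1 - 2 * l := by linarith
    unfold MIMO.dimPerUse
    positivity
  have : Nonempty (MIMO.SymbolIndex M N l) := by
    rw [← Fintype.card_pos_iff, ← Nat.cast_pos (α := ℝ), hcard]
    positivity
  have hinj := MIMO.injective_of_rank_eq hrank
  have hex : ∀ ρ : ℝ, ∃ S, 1 < ρ → _ := fun ρ => by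
    by_cases hρ : 1 < ρ
    · obtain ⟨S, hS⟩ := MIMO.exists_constellation hrank
        (γ := ρ ^ (r * (MIMO.channelUses M N l : ℝ))) (ρ := ρ) (by positivity) (by linarith)
      exact ⟨S, fun _ => hS⟩
    · exact ⟨∅, fun h => absurd h hρ⟩
  choose S hS using hex
  refine ⟨S, fun ρ hρ => ?_⟩
  intro A n T K sumEta
  have hρ0 : 0 < ρ := by linarith
  obtain ⟨hcons, htx, hrx, herr⟩ := hS ρ hρ
  have heta : (Matrix.toEuclideanLin A).normDet ^ 2 = ρ ^ (-sumEta) :=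
    (MIMO.rpow_neg_sum_singularExponent hρ hinj).symm
  have hnKT : (n : ℝ) = K * T := hcard
  have hγ : ρ ^ (r * T) / (Matrix.toEuclideanLin A).normDet ^ 2 = ρ ^ (r * T + sumEta) := by
    rw [heta, ← Real.rpow_sub hρ0, sub_neg_eq_add]
  refine ⟨hnKT, hcons, htx, ?_, herr.trans_eq ?_, ?_⟩
  · rw [MIMO.rxVNR_eq hρ0 (hrx.trans (congrArg _ hγ))]
    have hT' : T ≠ 0 := hT.ne'
    have hK' : K ≠ 0 := hK.ne'
    congr 2
    change 1 - (r * T + sumEta) / (n : ℝ) = _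
    rw [hnKT]
    field_simp
    ring
  · change ENNReal.ofReal (MIMO.errorConstant n *
      (ρ ^ (r * T) / (Matrix.toEuclideanLin A).normDet ^ 2) / ρ ^ n) = _
    rw [hγ, mul_div_assoc, ← Real.rpow_natCast, ← Real.rpow_sub hρ0, hnKT]
    congr 3
    ring
  · rw [← MIMO.normDet_sq_eq_det, heta, Real.rpow_neg hρ0.le, inv_inv, Real.rpow_add hρ0, mul_assoc]
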